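/- **Theorem 4.3.** Let $n\ge 2$, $\mathcal N=\{1,\dots,n\}$, and let $D_n^P$ be the set of diagonal $n\times n$ matrices with positive diagonal entries. For $A=[a_{i,j}]\in\mathbb C^{n\times n}$ put $r_i(A)=\sum_{j\ne i}|a_{i,j}|$, $c_i(A)=\sum_{j\ne i}|a_{j,i}|$ and, for $X\in D_n^P$, $r_i^X(A)=r_i(X^{-1}AX)$, $c_i^X(A)=c_i(X^{-1}AX)$. Write $A\in GDD$ (generalized diagonally dominant) if there is $X\in D_n^P$ with $|a_{i,i}|>r_i^X(A)$ for all $i\in\mathcal N$. Powers with exponent $0$ are equal to $1$ (also $0^0=1$). Let $A=[a_{i,j}]\in\mathbb C^{n\times n}$. For each single one of the following conditions (1)–(22), $A\in GDD$ if and only if there exist $X,Y\in D_n^P$ and $\alpha,\beta\in[0,1]$ (which may depend on the condition) such that this condition holds for all $i,j\in\mathcal N$ with $i\neq j$ (below, $r_i^X$, $c_i^Y$, etc. stand for $r_i^X(A)$, $c_i^Y(A)$, etc.): 1. $|a_{i,i}|>r_i^X$; 2. $|a_{i,i}|>c_i^Y$; 3. $|a_{i,i}|>(r_i^X)^{\alpha}(c_i^Y)^{1-\alpha}$;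 4. $|a_{i,i}|>\alpha r_i^X+(1-\alpha)c_i^Y$; 5. $|a_{i,i}||a_{j,j}|>r_i^Xr_j^X$; 6. $|a_{i,i}||a_{j,j}|>c_i^Yc_j^Y$; 7. $|a_{i,i}||a_{j,j}|>r_i^Xc_j^Y$; 8. $|a_{i,i}||a_{j,j}|>(r_i^Xr_j^X)^{\alpha}(c_i^Yc_j^Y)^{1-\alpha}$; 9. $|a_{i,i}||a_{j,j}|>(r_i^Xc_j^Y)^{\alpha}(r_j^Xc_i^Y)^{1-\alpha}$; 10. $|a_{i,i}||a_{j,j}|>\alpha r_i^Xr_j^X+(1-\alpha)c_i^Yc_j^Y$; 11. $|a_{i,i}||a_{j,j}|>\alpha r_i^Xc_j^Y+(1-\alpha)r_j^Xc_i^Y$; 12. $|a_{i,i}||a_{j,j}|>[\alpha r_i^X+(1-\alpha)c_i^Y][\alpha r_j^X+(1-\alpha)c_j^Y]$; 13. $|a_{i,i}||a_{j,j}|>[\alpha r_i^X+(1-\alpha)c_i^Y][\alpha c_j^Y+(1-\alpha)r_j^X]$; 14. $|a_{i,i}|^{\alpha}|a_{j,j}|^{1-\alpha}>(r_i^X)^{\alpha}(r_j^Y)^{1-\alpha}$;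 15. $|a_{i,i}|^{\alpha}|a_{j,j}|^{1-\alpha}>(c_i^X)^{\alpha}(c_j^Y)^{1-\alpha}$; 16. $|a_{i,i}|^{\alpha}|a_{j,j}|^{1-\alpha}>(r_i^X)^{\alpha}(c_j^Y)^{1-\alpha}$; 17. $|a_{i,i}|^{\alpha}|a_{j,j}|^{1-\alpha}>[(r_i^X)^{\beta}(c_i^Y)^{1-\beta}]^{\alpha}[(r_j^X)^{\beta}(c_j^Y)^{1-\beta}]^{1-\alpha}$; 18. $|a_{i,i}|^{\alpha}|a_{j,j}|^{1-\alpha}>[(r_i^X)^{\beta}(c_i^Y)^{1-\beta}]^{\alpha}[(c_j^Y)^{\beta}(r_j^X)^{1-\beta}]^{1-\alpha}$; 19. $|a_{i,i}|^{\alpha}|a_{j,j}|^{1-\alpha}>\beta(r_i^X)^{\alpha}(r_j^X)^{1-\alpha}+(1-\beta)(c_i^Y)^{\alpha}(c_j^Y)^{1-\alpha}$; 20. $|a_{i,i}|^{\alpha}|a_{j,j}|^{1-\alpha}>\beta(r_i^X)^{\alpha}(c_j^Y)^{1-\alpha}+(1-\beta)(c_i^Y)^{\alpha}(r_j^X)^{1-\alpha}$;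 21. $|a_{i,i}|^{\alpha}|a_{j,j}|^{1-\alpha}>[\beta r_i^X+(1-\beta)c_i^Y]^{\alpha}[\beta r_j^X+(1-\beta)c_j^Y]^{1-\alpha}$; 22. $|a_{i,i}|^{\alpha}|a_{j,j}|^{1-\alpha}>[\beta r_i^X+(1-\beta)c_i^Y]^{\alpha}[\beta c_j^Y+(1-\beta)r_j^X]^{1-\alpha}$. -/

import Mathlib

noncomputable section

namespace GenDiagDom

/-- The `i`-th deleted absolute row sum `r_i(A)`. -/
def rowSum {n : ℕ} (A : Matrix (Fin n) (Fin n) ℂ) (i : Fin n) : ℝ :=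
  ∑ j ∈ Finset.univ.erase i, ‖A i j‖

/-- The `i`-th deleted absolute column sum `c_i(A)`. -/
def colSum {n : ℕ} (A : Matrix (Fin n) (Fin n) ℂ) (i : Fin n) : ℝ :=
  ∑ j ∈ Finset.univ.erase i, ‖A j i‖

/-- The diagonal matrices of order `n` with positive (real) diagonal entries. -/
def posDiag (n : ℕ) : Set (Matrix (Fin n) (Fin n) ℂ) :=
  {X | ∃ x : Fin n → ℝ, (∀ i, 0 < x i) ∧ X = Matrix.diagonal (fun i => (x i : ℂ))}

/-- The weighted deleted absolute row sum `r_i^X(A) = r_i(X⁻¹ A X)`. -/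
def wRow {n : ℕ} (A X : Matrix (Fin n) (Fin n) ℂ) (i : Fin n) : ℝ :=
  rowSum (X⁻¹ * A * X) i

/-- The weighted deleted absolute column sum `c_i^X(A) = c_i(X⁻¹ A X)`. -/
def wCol {n : ℕ} (A X : Matrix (Fin n) (Fin n) ℂ) (i : Fin n) : ℝ :=
  colSum (X⁻¹ * A * X) i

/-- Strict diagonal dominance by rows. -/
def IsSDD {n : ℕ} (A : Matrix (Fin n) (Fin n) ℂ) : Prop :=
  ∀ i, rowSum A i < ‖A i i‖

/-- Generalized diagonal dominance by rows: `X⁻¹ A X` is strictly diagonally dominant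
for some diagonal `X` with positive diagonal. -/
def IsGDD {n : ℕ} (A : Matrix (Fin n) (Fin n) ℂ) : Prop :=
  ∃ X ∈ posDiag n, IsSDD (X⁻¹ * A * X)

/-- The `k`-th inequality, `1 ≤ k ≤ 22`, at the pair of indices `i, j`
(the first four do not involve `j`). Powers are real powers of nonnegative reals. -/
def Criterion {n : ℕ} (A X Y : Matrix (Fin n) (Fin n) ℂ) (α β : ℝ) (i j : Fin n) : ℕ → Prop
  | 1 => ‖A i i‖ > wRow A X i
  | 2 => ‖A i i‖ > wCol A Y i
  | 3 => ‖A i i‖ > wRow A X i ^ α * wCol A Y i ^ (1 - α)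
  | 4 => ‖A i i‖ > α * wRow A X i + (1 - α) * wCol A Y i
  | 5 => ‖A i i‖ * ‖A j j‖ > wRow A X i * wRow A X j
  | 6 => ‖A i i‖ * ‖A j j‖ > wCol A Y i * wCol A Y j
  | 7 => ‖A i i‖ * ‖A j j‖ > wRow A X i * wCol A Y j
  | 8 => ‖A i i‖ * ‖A j j‖ >
      (wRow A X i * wRow A X j) ^ α * (wCol A Y i * wCol A Y j) ^ (1 - α)
  | 9 => ‖A i i‖ * ‖A j j‖ >
      (wRow A X i * wCol A Y j) ^ α * (wRow A X j * wCol A Y i) ^ (1 - α)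
  | 10 => ‖A i i‖ * ‖A j j‖ >
      α * (wRow A X i * wRow A X j) + (1 - α) * (wCol A Y i * wCol A Y j)
  | 11 => ‖A i i‖ * ‖A j j‖ >
      α * (wRow A X i * wCol A Y j) + (1 - α) * (wRow A X j * wCol A Y i)
  | 12 => ‖A i i‖ * ‖A j j‖ >
      (α * wRow A X i + (1 - α) * wCol A Y i) * (α * wRow A X j + (1 - α) * wCol A Y j)
  | 13 => ‖A i i‖ * ‖A j j‖ >
      (α * wRow A X i + (1 - α) * wCol A Y i) * (α * wCol A Y j + (1 - α) * wRow A X j)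
  | 14 => ‖A i i‖ ^ α * ‖A j j‖ ^ (1 - α) > wRow A X i ^ α * wRow A Y j ^ (1 - α)
  | 15 => ‖A i i‖ ^ α * ‖A j j‖ ^ (1 - α) > wCol A X i ^ α * wCol A Y j ^ (1 - α)
  | 16 => ‖A i i‖ ^ α * ‖A j j‖ ^ (1 - α) > wRow A X i ^ α * wCol A Y j ^ (1 - α)
  | 17 => ‖A i i‖ ^ α * ‖A j j‖ ^ (1 - α) >
      (wRow A X i ^ β * wCol A Y i ^ (1 - β)) ^ α *
        (wRow A X j ^ β * wCol A Y j ^ (1 - β)) ^ (1 - α)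
  | 18 => ‖A i i‖ ^ α * ‖A j j‖ ^ (1 - α) >
      (wRow A X i ^ β * wCol A Y i ^ (1 - β)) ^ α *
        (wCol A Y j ^ β * wRow A X j ^ (1 - β)) ^ (1 - α)
  | 19 => ‖A i i‖ ^ α * ‖A j j‖ ^ (1 - α) >
      β * (wRow A X i ^ α * wRow A X j ^ (1 - α)) +
        (1 - β) * (wCol A Y i ^ α * wCol A Y j ^ (1 - α))
  | 20 => ‖A i i‖ ^ α * ‖A j j‖ ^ (1 - α) >
      β * (wRow A X i ^ α * wCol A Y j ^ (1 - α)) +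
        (1 - β) * (wCol A Y i ^ α * wRow A X j ^ (1 - α))
  | 21 => ‖A i i‖ ^ α * ‖A j j‖ ^ (1 - α) >
      (β * wRow A X i + (1 - β) * wCol A Y i) ^ α *
        (β * wRow A X j + (1 - β) * wCol A Y j) ^ (1 - α)
  | 22 => ‖A i i‖ ^ α * ‖A j j‖ ^ (1 - α) >
      (β * wRow A X i + (1 - β) * wCol A Y i) ^ α *
        (β * wCol A Y j + (1 - β) * wRow A X j) ^ (1 - α)
  | _ => False

end GenDiagDom

end

namespace GenDiagDom

open Finset

/-! Only the moduli `b i j = ‖A i j‖` matter. Let `M` have diagonal `b i i` and off-diagonal entries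
`-b i j`; then GDD means that `M x > 0` for some `x > 0`. This holds exactly when `u ≥ 0` and `M u ≤
0` force `u = 0`: comparison of `u` with `x` gives one direction, while convex separation yields a
positive `y` with `Mᵀ y > 0`. Combining the two makes the property invariant under transposition, so
row and column dominance agree up to a change of scaling.

The central sufficient condition is Ostrowski's, `r_i ^ γ * c_i ^ (1 - γ) < b i i` with independent
scalings (`rowDom_of_ostrowski`). Given `u ≥ 0` with `M u ≤ 0`, Hölder's inequality in each row
followed by summation over all rows forces `u = 0`. The product version for pairs
(`rowDom_of_brauer`) follows because at most one index can violate Ostrowski's inequality, and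
rescaling that single coordinate repairs it.

Every criterion reduces to one of these: arithmetic means dominate geometric means, and an
inequality asymmetric in `i, j` is multiplied by its swapped copy. Conversely, once rows and columns
are both dominant for suitable scalings, `α = β = 1` collapses all the criteria. -/

lemma update_mul_pos {ι : Type*} [DecidableEq ι] {x : ι → ℝ} (hx : ∀ i, 0 < x i) (k : ι)
    {t : ℝ} (ht : 0 < t) (i : ι) : 0 < Function.update x k (t * x k) i := by
  rcases eq_or_ne i k with rfl | h
  · simpa using mul_pos ht (hx i)
  · simpa [h] using hx i

/-! ### Dominance of real matrices, the theorem of the alternative and transposition -/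

section

variable {ι : Type*} [Fintype ι] [DecidableEq ι]

/-- The off-diagonal row sums of the real matrix `b`, after the similarity by `diag x`. -/
noncomputable def scaledRow (b : ι → ι → ℝ) (x : ι → ℝ) (i : ι) : ℝ :=
  ∑ j ∈ univ.erase i, b i j * x j / x i

/-- The off-diagonal column sums of the real matrix `b`, after the similarity by `diag y`. -/
noncomputable def scaledCol (b : ι → ι → ℝ) (y : ι → ℝ) (i : ι) : ℝ :=
  ∑ j ∈ univ.erase i, b j i * y i / y j

/-- Some diagonal similarity makes `b` strictly diagonally dominant by rows. -/
def RowDom (b : ι → ι → ℝ) : Prop :=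
  ∃ x : ι → ℝ, (∀ i, 0 < x i) ∧ ∀ i, scaledRow b x i < b i i

lemma scaledRow_nonneg {b : ι → ι → ℝ} (hb : ∀ i j, 0 ≤ b i j) {x : ι → ℝ} (hx : ∀ i, 0 < x i)
    (i : ι) : 0 ≤ scaledRow b x i :=
  sum_nonneg fun j _ => div_nonneg (mul_nonneg (hb i j) (hx j).le) (hx i).le

lemma scaledCol_nonneg {b : ι → ι → ℝ} (hb : ∀ i j, 0 ≤ b i j) {y : ι → ℝ} (hy : ∀ i, 0 < y i)
    (i : ι) : 0 ≤ scaledCol b y i :=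
  sum_nonneg fun j _ => div_nonneg (mul_nonneg (hb j i) (hy i).le) (hy j).le

/-- Transposing a diagonal similarity inverts the scaling; column statements thereby become row
statements. -/
lemma scaledCol_eq_scaledRow (b : ι → ι → ℝ) (y : ι → ℝ) :
    scaledCol b y = scaledRow (fun i j => b j i) y⁻¹ := by
  funext i
  refine sum_congr rfl fun j _ => ?_
  simp only [Pi.inv_apply, div_inv_eq_mul]
  ring

lemma scaledRow_eq_div (b : ι → ι → ℝ) (x : ι → ℝ) (i : ι) :
    scaledRow b x i = (∑ j ∈ univ.erase i, b i j * x j) / x i :=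
  (sum_div _ _ _).symm

/-- A generalized diagonally dominant matrix is injective on the nonnegative cone, in the strong
sense that `b i i * u i ≤ ∑ j ≠ i, b i j * u j` for all `i` forces `u = 0`. -/
lemma RowDom.eq_zero {b : ι → ι → ℝ} (hb : ∀ i j, 0 ≤ b i j) (h : RowDom b) {u : ι → ℝ}
    (hu : ∀ i, 0 ≤ u i) (hle : ∀ i, b i i * u i ≤ ∑ j ∈ univ.erase i, b i j * u j) : u = 0 := by
  obtain ⟨x, hx, hdom⟩ := h
  by_contra hne
  obtain ⟨k, hk⟩ := Function.ne_iff.mp hne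
  have hk' : 0 < u k := lt_of_le_of_ne (hu k) (Ne.symm hk)
  -- At a maximal ratio `u i / x i`, the vector `u` lies below that multiple of `x` and touches it
  -- at `i`, so strict dominance of row `i` contradicts `hle i`.
  obtain ⟨i, -, hi⟩ := exists_max_image univ (fun i => u i / x i) ⟨k, mem_univ k⟩
  have ht : 0 < u i / x i := lt_of_lt_of_le (div_pos hk' (hx k)) (hi k (mem_univ k))
  have h1 : ∑ j ∈ univ.erase i, b i j * u j ≤ (u i / x i) * ∑ j ∈ univ.erase i, b i j * x j := by
    rw [mul_sum]
    refine sum_le_sum fun j _ => ?_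
    have := (div_le_iff₀ (hx j)).mp (hi j (mem_univ j))
    calc b i j * u j ≤ b i j * (u i / x i * x j) := mul_le_mul_of_nonneg_left this (hb i j)
      _ = _ := by ring
  have h2 := hdom i
  rw [scaledRow_eq_div, div_lt_iff₀ (hx i)] at h2
  have h3 : u i / x i * (b i i * x i) = b i i * u i := by
    rw [mul_left_comm, div_mul_cancel₀ _ (hx i).ne']
  have h4 := hle i
  have h5 := mul_lt_mul_of_pos_left h2 ht
  linarith

/-- A theorem of the alternative for matrices with nonpositive off-diagonal entries. -/
lemma rowDom_transpose_of_eq_zero {b : ι → ι → ℝ} (hb : ∀ i j, 0 ≤ b i j)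
    (h : ∀ u : ι → ℝ, (∀ i, 0 ≤ u i) →
      (∀ i, b i i * u i ≤ ∑ j ∈ univ.erase i, b i j * u j) → u = 0) :
    RowDom fun i j => b j i := by
  let T : (ι → ℝ) →ₗ[ℝ] (ι → ℝ) :=
    { toFun := fun u i => ∑ j ∈ univ.erase i, b i j * u j - b i i * u i
      map_add' := fun u v => by
        funext i
        simp only [Pi.add_apply, mul_add, sum_add_distrib]
        ring
      map_smul' := fun c u => by
        funext i
        simp only [Pi.smul_apply, smul_eq_mul, RingHom.id_apply, mul_sub, mul_sum]
        congr 1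
        · exact sum_congr rfl fun j _ => by ring
        · ring }
  have hT : Continuous T := LinearMap.continuous_of_finiteDimensional T
  -- A point `u` of the simplex with `T u ≥ 0` would vanish by `h`, yet its coordinates sum to 1.
  have hdisj : Disjoint (T '' stdSimplex ℝ ι) (ProperCone.positive ℝ (ι → ℝ) : Set (ι → ℝ)) := by
    rw [Set.disjoint_left]
    rintro _ ⟨u, hu, rfl⟩ hmem
    have hmem' : 0 ≤ T u := by simpa using hmem
    have h0 := h u hu.1 fun i => sub_nonneg.mp (hmem' i)
    have := hu.2
    simp [h0] at this
  obtain ⟨f, hf0, hf⟩ := ProperCone.hyperplane_separation (ProperCone.positive ℝ (ι → ℝ))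
    ((convex_stdSimplex ℝ ι).linear_image T) ((isCompact_stdSimplex ℝ ι).image hT) hdisj
  -- The separating functional is nonnegative on the cone and negative on the image of the simplex;
  -- its coordinates are the scaling sought for the transpose.
  set y : ι → ℝ := fun i => f (Pi.single i 1) with hy
  have hy0 : ∀ i, 0 ≤ y i := fun i => hf0 _ (by
    simp)
  have hfv : ∀ v, f v = ∑ i, v i * y i := fun v => by
    conv_lhs => rw [pi_eq_sum_univ' v]
    simp [map_sum, hy]
  -- Negativity of `f` at the images of the vertices of the simplex.
  have key : ∀ i, ∑ j ∈ univ.erase i, b j i * y j < b i i * y i := fun i => by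
    have h1 := hf _ ⟨_, single_mem_stdSimplex ℝ i, rfl⟩
    rw [hfv, ← add_sum_erase _ _ (mem_univ i)] at h1
    have h2 : T (Pi.single i 1) i = - b i i := by
      have : ∑ j ∈ univ.erase i, b i j * (Pi.single i (1 : ℝ) : ι → ℝ) j = 0 :=
        sum_eq_zero fun j hj => by simp [ne_of_mem_erase hj]
      change ∑ j ∈ univ.erase i, b i j * (Pi.single i (1 : ℝ) : ι → ℝ) j - _ = _
      simp only [this, Pi.single_eq_same]
      ring
    have h3 : ∀ j ∈ univ.erase i, T (Pi.single i 1) j * y j = b j i * y j := fun j hj => by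
      have hji := ne_of_mem_erase hj
      have : ∑ l ∈ univ.erase j, b j l * (Pi.single i (1 : ℝ) : ι → ℝ) l = b j i := by
        rw [sum_eq_single_of_mem i (by simp [hji.symm]) fun l _ hl => by simp [hl]]
        simp
      change (∑ l ∈ univ.erase j, b j l * (Pi.single i (1 : ℝ) : ι → ℝ) l - _) * _ = _
      rw [this, Pi.single_eq_of_ne hji, mul_zero, sub_zero]
    rw [h2, sum_congr rfl h3] at h1
    linarith
  have hypos : ∀ i, 0 < y i := fun i => by
    refine lt_of_le_of_ne (hy0 i) fun h0 => ?_
    have h1 := key i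
    have h2 : 0 ≤ ∑ j ∈ univ.erase i, b j i * y j :=
      sum_nonneg fun j _ => mul_nonneg (hb j i) (hy0 j)
    rw [← h0, mul_zero] at h1
    linarith
  refine ⟨y, hypos, fun i => ?_⟩
  rw [scaledRow_eq_div, div_lt_iff₀ (hypos i)]
  exact key i

lemma RowDom.transpose {b : ι → ι → ℝ} (hb : ∀ i j, 0 ≤ b i j) (h : RowDom b) :
    RowDom fun i j => b j i :=
  rowDom_transpose_of_eq_zero hb fun _ => h.eq_zero hb

/-- Separation only reaches the transpose; a second transposition returns to `b`. -/
lemma rowDom_of_eq_zero {b : ι → ι → ℝ} (hb : ∀ i j, 0 ≤ b i j)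
    (h : ∀ u : ι → ℝ, (∀ i, 0 ≤ u i) →
      (∀ i, b i i * u i ≤ ∑ j ∈ univ.erase i, b i j * u j) → u = 0) : RowDom b :=
  (rowDom_transpose_of_eq_zero hb h).transpose fun i j => hb j i

lemma rowDom_of_scaledCol_lt {b : ι → ι → ℝ} (hb : ∀ i j, 0 ≤ b i j) {y : ι → ℝ}
    (hy : ∀ i, 0 < y i) (h : ∀ i, scaledCol b y i < b i i) : RowDom b := by
  rw [scaledCol_eq_scaledRow] at h
  exact RowDom.transpose (b := fun i j => b j i) (fun i j => hb j i)
    ⟨y⁻¹, fun i => inv_pos.mpr (hy i), h⟩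

lemma RowDom.exists_scaledCol_lt {b : ι → ι → ℝ} (hb : ∀ i j, 0 ≤ b i j) (h : RowDom b) :
    ∃ y : ι → ℝ, (∀ i, 0 < y i) ∧ ∀ i, scaledCol b y i < b i i := by
  obtain ⟨x, hx, hdom⟩ := h.transpose hb
  refine ⟨x⁻¹, fun i => inv_pos.mpr (hx i), fun i => ?_⟩
  rw [scaledCol_eq_scaledRow, inv_inv]
  exact hdom i

/-! ### Hölder's inequality and Ostrowski's criterion -/

/-- Hölder's inequality in geometric-mean form, including the endpoint exponents. -/
lemma sum_rpow_mul_rpow_le {κ : Type*} (s : Finset κ) {f g : κ → ℝ} (hf : ∀ j ∈ s, 0 ≤ f j)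
    (hg : ∀ j ∈ s, 0 ≤ g j) {γ : ℝ} (h0 : 0 ≤ γ) (h1 : γ ≤ 1) :
    ∑ j ∈ s, f j ^ γ * g j ^ (1 - γ) ≤ (∑ j ∈ s, f j) ^ γ * (∑ j ∈ s, g j) ^ (1 - γ) := by
  rcases h0.eq_or_lt with rfl | h0
  · simp
  rcases h1.eq_or_lt with rfl | h1
  · simp
  have h1' : 0 < 1 - γ := sub_pos.mpr h1
  have hpq : (1 / γ).HolderConjugate (1 / (1 - γ)) := by
    rw [Real.holderConjugate_iff]
    refine ⟨by rwa [lt_div_iff₀ h0, one_mul], by simp⟩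
  have := Real.inner_le_Lp_mul_Lq_of_nonneg s hpq (fun j hj => Real.rpow_nonneg (hf j hj) γ)
    (fun j hj => Real.rpow_nonneg (hg j hj) (1 - γ))
  have hf' : ∑ j ∈ s, (f j ^ γ) ^ (1 / γ) = ∑ j ∈ s, f j := sum_congr rfl fun j hj => by
    rw [← Real.rpow_mul (hf j hj), mul_one_div_cancel h0.ne', Real.rpow_one]
  have hg' : ∑ j ∈ s, (g j ^ (1 - γ)) ^ (1 / (1 - γ)) = ∑ j ∈ s, g j :=
    sum_congr rfl fun j hj => by
      rw [← Real.rpow_mul (hg j hj), mul_one_div_cancel h1'.ne', Real.rpow_one]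
  rwa [one_div_one_div, one_div_one_div, hf', hg'] at this

lemma rpow_mul_rpow_one_sub {c γ : ℝ} (hc : 0 ≤ c) (h0 : 0 ≤ γ) (h1 : γ ≤ 1) :
    c ^ γ * c ^ (1 - γ) = c := by
  rw [← Real.rpow_add_of_nonneg hc h0 (sub_nonneg.mpr h1), add_sub_cancel, Real.rpow_one]

/-- Entries of `diag z⁻¹ * b * diag z` for the geometric mean `z` of `x` and `y`. -/
lemma entry_geom_mean {b p q p' q' γ : ℝ} (hb : 0 ≤ b) (hp : 0 < p) (hq : 0 < q) (hp' : 0 < p')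
    (hq' : 0 < q') (h0 : 0 ≤ γ) (h1 : γ ≤ 1) :
    b * (p ^ γ * q ^ (1 - γ)) / (p' ^ γ * q' ^ (1 - γ)) =
      (b * p / p') ^ γ * (b * q / q') ^ (1 - γ) := by
  rw [Real.div_rpow (by positivity) hp'.le, Real.div_rpow (by positivity) hq'.le,
    Real.mul_rpow hb hp.le, Real.mul_rpow hb hq.le]
  conv_lhs => rw [← rpow_mul_rpow_one_sub hb h0 h1]
  have := (Real.rpow_pos_of_pos hp' γ).ne'
  have := (Real.rpow_pos_of_pos hq' (1 - γ)).ne'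
  field_simp

lemma scaledRow_geom_mean_le {b : ι → ι → ℝ} (hb : ∀ i j, 0 ≤ b i j) {x y : ι → ℝ}
    (hx : ∀ i, 0 < x i) (hy : ∀ i, 0 < y i) {γ : ℝ} (h0 : 0 ≤ γ) (h1 : γ ≤ 1) (i : ι) :
    scaledRow b (fun i => x i ^ γ * y i ^ (1 - γ)) i ≤
      scaledRow b x i ^ γ * scaledRow b y i ^ (1 - γ) := by
  unfold scaledRow
  rw [sum_congr rfl fun j _ => entry_geom_mean (hb i j) (hx j) (hy j) (hx i) (hy i) h0 h1]
  exact sum_rpow_mul_rpow_le _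
    (fun j _ => div_nonneg (mul_nonneg (hb i j) (hx j).le) (hx i).le)
    (fun j _ => div_nonneg (mul_nonneg (hb i j) (hy j).le) (hy i).le) h0 h1

lemma scaledCol_geom_mean_le {b : ι → ι → ℝ} (hb : ∀ i j, 0 ≤ b i j) {x y : ι → ℝ}
    (hx : ∀ i, 0 < x i) (hy : ∀ i, 0 < y i) {γ : ℝ} (h0 : 0 ≤ γ) (h1 : γ ≤ 1) (i : ι) :
    scaledCol b (fun i => x i ^ γ * y i ^ (1 - γ)) i ≤
      scaledCol b x i ^ γ * scaledCol b y i ^ (1 - γ) := by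
  unfold scaledCol
  rw [sum_congr rfl fun j _ => entry_geom_mean (hb j i) (hx i) (hy i) (hx j) (hy j) h0 h1]
  exact sum_rpow_mul_rpow_le _
    (fun j _ => div_nonneg (mul_nonneg (hb j i) (hx i).le) (hx j).le)
    (fun j _ => div_nonneg (mul_nonneg (hb j i) (hy i).le) (hy j).le) h0 h1

/-- Ostrowski's criterion, with independent scalings for the rows and for the columns. -/
lemma rowDom_of_ostrowski {b : ι → ι → ℝ} (hb : ∀ i j, 0 ≤ b i j) {x y : ι → ℝ}
    (hx : ∀ i, 0 < x i) (hy : ∀ i, 0 < y i) {γ : ℝ} (h0 : 0 ≤ γ) (h1 : γ ≤ 1)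
    (h : ∀ i, scaledRow b x i ^ γ * scaledCol b y i ^ (1 - γ) < b i i) : RowDom b := by
  rcases h1.eq_or_lt with rfl | h1
  · exact ⟨x, hx, fun i => by simpa using h i⟩
  have hγ : 0 < 1 - γ := sub_pos.mpr h1
  have hR := scaledRow_nonneg hb hx
  have hC := scaledCol_nonneg hb hy
  have hd : ∀ i, 0 < b i i := fun i => lt_of_le_of_lt
    (mul_nonneg (Real.rpow_nonneg (hR i) _) (Real.rpow_nonneg (hC i) _)) (h i)
  refine rowDom_of_eq_zero hb fun u hu hle => ?_
  set z : ι → ℝ := fun i => x i ^ γ * y i ^ (1 - γ) with hz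
  have hzpos : ∀ i, 0 < z i := fun i =>
    mul_pos (Real.rpow_pos_of_pos (hx i) _) (Real.rpow_pos_of_pos (hy i) _)
  -- The exponent makes `w ^ (1 - γ) = u / z`, so that Hölder leaves a sum linear in `w`; the case
  -- `γ = 1` had to be split off for this.
  set w : ι → ℝ := fun i => (u i / z i) ^ (1 / (1 - γ)) with hw
  have hv0 : ∀ i, 0 ≤ u i / z i := fun i => div_nonneg (hu i) (hzpos i).le
  have hw0 : ∀ i, 0 ≤ w i := fun i => Real.rpow_nonneg (hv0 i) _
  have hww : ∀ i, w i ^ (1 - γ) = u i / z i := fun i => by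
    rw [hw, ← Real.rpow_mul (hv0 i), one_div_mul_cancel hγ.ne', Real.rpow_one]
  set q : ι → ι → ℝ := fun i j => b i j * y j / y i with hq
  have hq0 : ∀ i j, 0 ≤ q i j := fun i j => div_nonneg (mul_nonneg (hb i j) (hy j).le) (hy i).le
  have hS0 : ∀ i, 0 ≤ ∑ j ∈ univ.erase i, q i j * w j := fun i =>
    sum_nonneg fun j _ => mul_nonneg (hq0 i j) (hw0 j)
  have hholder : ∀ i, b i i * w i ^ (1 - γ) ≤
      scaledRow b x i ^ γ * (∑ j ∈ univ.erase i, q i j * w j) ^ (1 - γ) := fun i => by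
    calc b i i * w i ^ (1 - γ) = b i i * u i / z i := by rw [hww]; ring
      _ ≤ (∑ j ∈ univ.erase i, b i j * u j) / z i := by
        have := hzpos i
        gcongr
        exact hle i
      _ = ∑ j ∈ univ.erase i, (b i j * x j / x i) ^ γ * (q i j * w j) ^ (1 - γ) := by
        rw [sum_div]
        refine sum_congr rfl fun j _ => ?_
        rw [Real.mul_rpow (hq0 i j) (hw0 j), hww, ← mul_assoc,
          ← entry_geom_mean (hb i j) (hx j) (hy j) (hx i) (hy i) h0 h1.le]
        have := (hzpos j).ne'
        have h2 : x j ^ γ * y j ^ (1 - γ) = z j := rfl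
        have h3 : x i ^ γ * y i ^ (1 - γ) = z i := rfl
        rw [h2, h3]
        field_simp
      _ ≤ _ := sum_rpow_mul_rpow_le _
        (fun j _ => div_nonneg (mul_nonneg (hb i j) (hx j).le) (hx i).le)
        (fun j _ => mul_nonneg (hq0 i j) (hw0 j)) h0 h1.le
  have hlt : ∀ i, 0 < w i → scaledCol b y i * w i < ∑ j ∈ univ.erase i, q i j * w j := by
    intro i hi
    have h2 := hholder i
    by_contra! hcon
    have h3 : (∑ j ∈ univ.erase i, q i j * w j) ^ (1 - γ) ≤
        scaledCol b y i ^ (1 - γ) * w i ^ (1 - γ) := by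
      rw [← Real.mul_rpow (hC i) hi.le]
      exact Real.rpow_le_rpow (hS0 i) hcon hγ.le
    have h4 := mul_le_mul_of_nonneg_left h3 (Real.rpow_nonneg (hR i) γ)
    have h5 := mul_lt_mul_of_pos_right (h i) (Real.rpow_pos_of_pos hi (1 - γ))
    linarith
  -- The column sums of `q` are the numbers `scaledCol b y i`, so the inequalities `hlt` cannot hold
  -- after summation over `i` unless `w = 0`.
  have hswap : ∑ i, ∑ j ∈ univ.erase i, q i j * w j = ∑ i, scaledCol b y i * w i := by
    rw [sum_comm' (t' := univ) (s' := fun j => univ.erase j) (by simp [ne_comm])]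
    exact sum_congr rfl fun i _ => (sum_mul _ _ _).symm
  by_contra hne
  obtain ⟨k, hk⟩ := Function.ne_iff.mp hne
  have hwk : 0 < w k :=
    Real.rpow_pos_of_pos (div_pos (lt_of_le_of_ne (hu k) (Ne.symm hk)) (hzpos k)) _
  refine absurd hswap (ne_of_gt (sum_lt_sum (fun i _ => ?_) ⟨k, mem_univ k, hlt k hwk⟩))
  rcases (hw0 i).eq_or_lt with h2 | h2
  · rw [← h2, mul_zero]
    exact hS0 i
  · exact (hlt i h2).le

/-! ### Rescaling one coordinate and the Brauer-type criterion -/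

lemma scaledRow_update_self (b : ι → ι → ℝ) (x : ι → ℝ) (k : ι) (t : ℝ) :
    scaledRow b (Function.update x k (t * x k)) k = scaledRow b x k / t := by
  unfold scaledRow
  rw [sum_div]
  refine sum_congr rfl fun j hj => ?_
  rw [Function.update_self, Function.update_of_ne (ne_of_mem_erase hj), div_div, mul_comm t]

lemma scaledRow_update_le {b : ι → ι → ℝ} (hb : ∀ i j, 0 ≤ b i j) {x : ι → ℝ}
    (hx : ∀ i, 0 < x i) {k i : ι} (hik : i ≠ k) {t : ℝ} (ht : 1 ≤ t) :
    scaledRow b (Function.update x k (t * x k)) i ≤ t * scaledRow b x i := by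
  unfold scaledRow
  rw [mul_sum]
  refine sum_le_sum fun j _ => ?_
  have h0 : 0 ≤ b i j * x j / x i := div_nonneg (mul_nonneg (hb i j) (hx j).le) (hx i).le
  rw [Function.update_of_ne hik]
  rcases eq_or_ne j k with rfl | hj
  · rw [Function.update_self]
    exact le_of_eq (by ring)
  · rw [Function.update_of_ne hj]
    exact le_mul_of_one_le_left h0 ht

/-- The Brauer-type product version of `rowDom_of_ostrowski`. -/
lemma rowDom_of_brauer [Nontrivial ι] {b : ι → ι → ℝ} (hb : ∀ i j, 0 ≤ b i j) {x y : ι → ℝ}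
    (hx : ∀ i, 0 < x i) (hy : ∀ i, 0 < y i) {γ : ℝ} (h0 : 0 ≤ γ) (h1 : γ ≤ 1)
    (h : ∀ i j, i ≠ j →
      (scaledRow b x i ^ γ * scaledCol b y i ^ (1 - γ)) *
        (scaledRow b x j ^ γ * scaledCol b y j ^ (1 - γ)) < b i i * b j j) : RowDom b := by
  have hR := scaledRow_nonneg hb hx
  have hC := scaledCol_nonneg hb hy
  set s : ι → ℝ := fun i => scaledRow b x i ^ γ * scaledCol b y i ^ (1 - γ) with hs
  have hs0 : ∀ i, 0 ≤ s i := fun i =>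
    mul_nonneg (Real.rpow_nonneg (hR i) _) (Real.rpow_nonneg (hC i) _)
  have hd : ∀ i, 0 < b i i := fun i => by
    obtain ⟨j, hj⟩ := exists_ne i
    have h2 := (mul_nonneg (hs0 i) (hs0 j)).trans_lt (h i j hj.symm)
    exact pos_of_mul_pos_left h2 (hb j j)
  by_cases hall : ∀ i, s i < b i i
  · exact rowDom_of_ostrowski hb hx hy h0 h1 hall
  push Not at hall
  obtain ⟨k, hk⟩ := hall
  -- Any `t` slightly above `s k / b k k` works: row and column sums at `k` are divided by `t`, the
  -- others grow at most by the factor `t`. The pair inequality for `k, i` leaves room for this, as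
  -- it says `(s k / b k k) * s i < b i i`.
  have ht0 : 1 ≤ s k / b k k := (one_le_div (hd k)).mpr hk
  have hev : ∀ᶠ t in nhdsWithin (s k / b k k) (Set.Ioi (s k / b k k)),
      ∀ i, i ≠ k → t * s i < b i i := by
    rw [Filter.eventually_all]
    intro i
    by_cases hik : i = k
    · simp [hik]
    have hlt : s k / b k k * s i < b i i := by
      rw [div_mul_eq_mul_div, div_lt_iff₀ (hd k), mul_comm, mul_comm (b i i)]
      have := h i k hik
      rw [mul_comm (b k k)]
      exact this
    have hc : Filter.Tendsto (fun t : ℝ => t * s i)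
        (nhdsWithin (s k / b k k) (Set.Ioi (s k / b k k))) (nhds (s k / b k k * s i)) :=
      ((continuous_id.mul continuous_const).tendsto _).mono_left nhdsWithin_le_nhds
    filter_upwards [hc.eventually_lt_const hlt] with t ht _ using ht
  obtain ⟨t, ht, htk⟩ := (hev.and self_mem_nhdsWithin).exists
  have htk' : s k / b k k < t := htk
  have ht1 : 1 ≤ t := ht0.trans htk'.le
  have htpos : 0 < t := one_pos.trans_le ht1
  have hyi : ∀ i, 0 < y⁻¹ i := fun i => inv_pos.mpr (hy i)
  have hx' := update_mul_pos hx k htpos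
  -- Column sums see the inverse scaling, so `y k` is divided by `t` while `x k` is multiplied by
  -- it.
  have hy' : ∀ i, 0 < (Function.update y⁻¹ k (t * y⁻¹ k))⁻¹ i := fun i =>
    inv_pos.mpr (update_mul_pos hyi k htpos i)
  have hmul : ∀ c i, 0 ≤ c →
      (c * scaledRow b x i) ^ γ * (c * scaledCol b y i) ^ (1 - γ) = c * s i := fun c i hc => by
    rw [Real.mul_rpow hc (hR i), Real.mul_rpow hc (hC i), mul_mul_mul_comm,
      rpow_mul_rpow_one_sub hc h0 h1]
  refine rowDom_of_ostrowski hb hx' hy' h0 h1 fun i => ?_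
  have hC' := scaledCol_nonneg hb hy' i
  have hR' := scaledRow_nonneg hb hx' i
  rcases eq_or_ne i k with rfl | hik
  · rw [scaledCol_eq_scaledRow, inv_inv, scaledRow_update_self, scaledRow_update_self,
      ← scaledCol_eq_scaledRow, div_eq_inv_mul, div_eq_inv_mul, hmul _ _ (inv_pos.mpr htpos).le,
      ← div_eq_inv_mul, div_lt_iff₀ htpos]
    rwa [div_lt_iff₀' (hd i)] at htk'
  · refine lt_of_le_of_lt ?_ (ht i hik)
    rw [← hmul t i htpos.le]
    refine mul_le_mul (Real.rpow_le_rpow hR' (scaledRow_update_le hb hx hik ht1) h0)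
      (Real.rpow_le_rpow hC' ?_ (sub_nonneg.mpr h1)) (Real.rpow_nonneg hC' _)
      (Real.rpow_nonneg (mul_nonneg htpos.le (hR i)) _)
    rw [scaledCol_eq_scaledRow, inv_inv, scaledCol_eq_scaledRow]
    exact scaledRow_update_le (fun i j => hb j i) hyi hik ht1

/-! ### Power inequalities for a pair and its swap -/

/-- Multiplying a weighted inequality for a pair by the one for the swapped pair. -/
lemma mul_lt_of_weighted {p q c d a e α : ℝ} (hp : 0 ≤ p) (hq : 0 ≤ q) (hc : 0 ≤ c) (hd : 0 ≤ d)
    (ha : 0 ≤ a) (he : 0 ≤ e) (h0 : 0 ≤ α) (h1 : α ≤ 1)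
    (h : p ^ α * d ^ (1 - α) < a ^ α * e ^ (1 - α))
    (h' : q ^ α * c ^ (1 - α) < e ^ α * a ^ (1 - α)) :
    (p ^ α * c ^ (1 - α)) * (q ^ α * d ^ (1 - α)) < a * e := by
  have h2 := mul_lt_mul'' h h' (by positivity) (by positivity)
  calc _ = p ^ α * d ^ (1 - α) * (q ^ α * c ^ (1 - α)) := by ring
    _ < _ := h2
    _ = (a ^ α * a ^ (1 - α)) * (e ^ α * e ^ (1 - α)) := by ring
    _ = a * e := by rw [rpow_mul_rpow_one_sub ha h0 h1, rpow_mul_rpow_one_sub he h0 h1]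

lemma mul_lt_of_weighted_self {p q a e α : ℝ} (hp : 0 ≤ p) (hq : 0 ≤ q)
    (ha : 0 ≤ a) (he : 0 ≤ e) (h0 : 0 ≤ α) (h1 : α ≤ 1)
    (h : p ^ α * q ^ (1 - α) < a ^ α * e ^ (1 - α))
    (h' : q ^ α * p ^ (1 - α) < e ^ α * a ^ (1 - α)) : p * q < a * e := by
  have := mul_lt_of_weighted hp hq hp hq ha he h0 h1 h h'
  rwa [rpow_mul_rpow_one_sub hp h0 h1, rpow_mul_rpow_one_sub hq h0 h1] at this

/-- In the product of the two hypotheses the exponents `α` and `1 - α` recombine to give `p * d * q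
* c < (a * e) ^ 2`; a square root gives the exponent `1 / 2`, whatever `α` is. -/
lemma mul_lt_of_crossed {p q c d a e α : ℝ} (hp : 0 ≤ p) (hq : 0 ≤ q) (hc : 0 ≤ c) (hd : 0 ≤ d)
    (ha : 0 ≤ a) (he : 0 ≤ e) (h0 : 0 ≤ α) (h1 : α ≤ 1)
    (h : (p * d) ^ α * (q * c) ^ (1 - α) < a * e)
    (h' : (q * c) ^ α * (p * d) ^ (1 - α) < e * a) :
    (p ^ (1 / 2 : ℝ) * c ^ (1 - 1 / 2 : ℝ)) * (q ^ (1 / 2 : ℝ) * d ^ (1 - 1 / 2 : ℝ)) < a * e := by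
  have h2 := mul_lt_mul'' h h' (by positivity) (by positivity)
  refine lt_of_mul_self_lt_mul_self₀ (by positivity) (lt_of_eq_of_lt ?_
    (h2.trans_eq (by ring : a * e * (e * a) = a * e * (a * e))))
  have sq : ∀ {z : ℝ}, 0 ≤ z → z ^ (1 / 2 : ℝ) * z ^ (1 - 1 / 2 : ℝ) = z := fun hz =>
    rpow_mul_rpow_one_sub hz (by norm_num) (by norm_num)
  have half : (1 - 1 / 2 : ℝ) = 1 / 2 := by norm_num
  calc _ = (p ^ (1 / 2 : ℝ) * p ^ (1 - 1 / 2 : ℝ)) * (q ^ (1 / 2 : ℝ) * q ^ (1 - 1 / 2 : ℝ)) *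
        (c ^ (1 / 2 : ℝ) * c ^ (1 - 1 / 2 : ℝ)) * (d ^ (1 / 2 : ℝ) * d ^ (1 - 1 / 2 : ℝ)) := by
        rw [half]
        ring
    _ = (p * d) * (q * c) := by
        rw [sq hp, sq hq, sq hc, sq hd]
        ring
    _ = ((p * d) ^ α * (p * d) ^ (1 - α)) * ((q * c) ^ α * (q * c) ^ (1 - α)) := by
        rw [rpow_mul_rpow_one_sub (mul_nonneg hp hd) h0 h1,
          rpow_mul_rpow_one_sub (mul_nonneg hq hc) h0 h1]
    _ = _ := by ring

lemma rpow_mul_rpow_swapped {p c α β : ℝ} (hp : 0 ≤ p) (hc : 0 ≤ c) (hα : 0 ≤ α) (hα' : α ≤ 1)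
    (hβ : 0 ≤ β) (hβ' : β ≤ 1) :
    (p ^ β * c ^ (1 - β)) ^ α * (c ^ β * p ^ (1 - β)) ^ (1 - α) =
      p ^ (β * α + (1 - β) * (1 - α)) * c ^ (1 - (β * α + (1 - β) * (1 - α))) := by
  have h1 : 0 ≤ 1 - α := sub_nonneg.mpr hα'
  have h2 : 0 ≤ 1 - β := sub_nonneg.mpr hβ'
  have e : 1 - (β * α + (1 - β) * (1 - α)) = (1 - β) * α + β * (1 - α) := by ring
  rw [e, Real.rpow_add_of_nonneg hp (by positivity) (by positivity),
    Real.rpow_add_of_nonneg hc (by positivity) (by positivity),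
    Real.mul_rpow (by positivity) (by positivity), Real.mul_rpow (by positivity) (by positivity),
    Real.rpow_mul hp, Real.rpow_mul hp, Real.rpow_mul hc, Real.rpow_mul hc]
  ring

lemma rpow_mul_rpow_comm {p q c d α β : ℝ} (hp : 0 ≤ p) (hq : 0 ≤ q) (hc : 0 ≤ c) (hd : 0 ≤ d) :
    (p ^ α * q ^ (1 - α)) ^ β * (c ^ α * d ^ (1 - α)) ^ (1 - β) =
      (p ^ β * c ^ (1 - β)) ^ α * (q ^ β * d ^ (1 - β)) ^ (1 - α) := by
  rw [Real.mul_rpow (by positivity) (by positivity), Real.mul_rpow (by positivity) (by positivity),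
    Real.mul_rpow (by positivity) (by positivity), Real.mul_rpow (by positivity) (by positivity),
    ← Real.rpow_mul hp, ← Real.rpow_mul hp, ← Real.rpow_mul hc, ← Real.rpow_mul hc,
    ← Real.rpow_mul hq, ← Real.rpow_mul hq, ← Real.rpow_mul hd, ← Real.rpow_mul hd,
    mul_comm β α, mul_comm β (1 - α), mul_comm (1 - β) α, mul_comm (1 - β) (1 - α)]
  ring

end

/-! ### Transfer to complex matrices -/

section

variable {n : ℕ} {A : Matrix (Fin n) (Fin n) ℂ}

lemma norm_inv_mul_mul_diagonal {x : Fin n → ℝ} (hx : ∀ i, 0 < x i) (i j : Fin n) :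
    ‖((Matrix.diagonal fun i => (x i : ℂ))⁻¹ * A * Matrix.diagonal fun i => (x i : ℂ)) i j‖ =
      ‖A i j‖ * x j / x i := by
  have hinv : (Matrix.diagonal fun i => (x i : ℂ))⁻¹ = Matrix.diagonal fun i => ((x i : ℂ))⁻¹ := by
    refine Matrix.inv_eq_left_inv ?_
    rw [Matrix.diagonal_mul_diagonal, ← Matrix.diagonal_one]
    congr 1
    funext k
    exact inv_mul_cancel₀ (Complex.ofReal_ne_zero.mpr (hx k).ne')
  rw [hinv, Matrix.mul_diagonal, Matrix.diagonal_mul, norm_mul, norm_mul, norm_inv,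
    Complex.norm_real, Complex.norm_real, Real.norm_of_nonneg (hx i).le,
    Real.norm_of_nonneg (hx j).le]
  ring

lemma wRow_diagonal {x : Fin n → ℝ} (hx : ∀ i, 0 < x i) :
    wRow A (Matrix.diagonal fun i => (x i : ℂ)) = scaledRow (fun i j => ‖A i j‖) x := by
  funext i
  unfold wRow rowSum scaledRow
  exact sum_congr rfl fun j _ => norm_inv_mul_mul_diagonal hx i j

lemma wCol_diagonal {y : Fin n → ℝ} (hy : ∀ i, 0 < y i) :
    wCol A (Matrix.diagonal fun i => (y i : ℂ)) = scaledCol (fun i j => ‖A i j‖) y := by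
  funext i
  unfold wCol colSum scaledCol
  exact sum_congr rfl fun j _ => norm_inv_mul_mul_diagonal hy j i

lemma isGDD_iff_rowDom : IsGDD A ↔ RowDom fun i j => ‖A i j‖ := by
  have key : ∀ {x : Fin n → ℝ}, (∀ i, 0 < x i) → ∀ i,
      ‖((Matrix.diagonal fun i => (x i : ℂ))⁻¹ * A * Matrix.diagonal fun i => (x i : ℂ)) i i‖ =
        ‖A i i‖ := fun hx i => by
    rw [norm_inv_mul_mul_diagonal hx, mul_div_cancel_right₀ _ (hx i).ne']
  constructor
  · rintro ⟨_, ⟨x, hx, rfl⟩, h⟩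
    refine ⟨x, hx, fun i => ?_⟩
    rw [← wRow_diagonal hx]
    exact (h i).trans_eq (key hx i)
  · rintro ⟨x, hx, h⟩
    refine ⟨_, ⟨x, hx, rfl⟩, fun i => ?_⟩
    rw [key hx]
    exact lt_of_eq_of_lt (congrFun (wRow_diagonal hx) i) (h i)

lemma IsGDD.exists_wRow_lt (h : IsGDD A) : ∃ X ∈ posDiag n, ∀ i, wRow A X i < ‖A i i‖ := by
  obtain ⟨x, hx, hdom⟩ := isGDD_iff_rowDom.mp h
  exact ⟨_, ⟨x, hx, rfl⟩, fun i => by rw [wRow_diagonal hx]; exact hdom i⟩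

lemma IsGDD.exists_wCol_lt (h : IsGDD A) : ∃ Y ∈ posDiag n, ∀ i, wCol A Y i < ‖A i i‖ := by
  obtain ⟨y, hy, hdom⟩ := (isGDD_iff_rowDom.mp h).exists_scaledCol_lt fun _ _ => norm_nonneg _
  exact ⟨_, ⟨y, hy, rfl⟩, fun i => by rw [wCol_diagonal hy]; exact hdom i⟩

lemma wRow_nonneg (X : Matrix (Fin n) (Fin n) ℂ) (i : Fin n) : 0 ≤ wRow A X i := by
  unfold wRow rowSum
  exact sum_nonneg fun _ _ => norm_nonneg _

lemma wCol_nonneg (X : Matrix (Fin n) (Fin n) ℂ) (i : Fin n) : 0 ≤ wCol A X i := by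
  unfold wCol colSum
  exact sum_nonneg fun _ _ => norm_nonneg _

lemma isGDD_of_wCol_lt {Y : Matrix (Fin n) (Fin n) ℂ} (hY : Y ∈ posDiag n)
    (h : ∀ i, wCol A Y i < ‖A i i‖) : IsGDD A := by
  obtain ⟨y, hy, rfl⟩ := hY
  rw [wCol_diagonal hy] at h
  exact isGDD_iff_rowDom.mpr (rowDom_of_scaledCol_lt (fun _ _ => norm_nonneg _) hy h)

lemma isGDD_of_wRow_lt {X : Matrix (Fin n) (Fin n) ℂ} (hX : X ∈ posDiag n)
    (h : ∀ i, wRow A X i < ‖A i i‖) : IsGDD A := by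
  obtain ⟨x, hx, rfl⟩ := hX
  rw [wRow_diagonal hx] at h
  exact isGDD_iff_rowDom.mpr ⟨x, hx, h⟩

lemma isGDD_of_ostrowski {X Y : Matrix (Fin n) (Fin n) ℂ} (hX : X ∈ posDiag n)
    (hY : Y ∈ posDiag n) {γ : ℝ} (hγ : γ ∈ Set.Icc (0 : ℝ) 1)
    (h : ∀ i, wRow A X i ^ γ * wCol A Y i ^ (1 - γ) < ‖A i i‖) : IsGDD A := by
  obtain ⟨x, hx, rfl⟩ := hX
  obtain ⟨y, hy, rfl⟩ := hY
  rw [wRow_diagonal hx, wCol_diagonal hy] at h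
  exact isGDD_iff_rowDom.mpr
    (rowDom_of_ostrowski (fun _ _ => norm_nonneg _) hx hy hγ.1 hγ.2 h)

lemma isGDD_of_brauer (hn : 2 ≤ n) {X Y : Matrix (Fin n) (Fin n) ℂ} (hX : X ∈ posDiag n)
    (hY : Y ∈ posDiag n) {γ : ℝ} (hγ : γ ∈ Set.Icc (0 : ℝ) 1)
    (h : ∀ i j, i ≠ j → (wRow A X i ^ γ * wCol A Y i ^ (1 - γ)) *
      (wRow A X j ^ γ * wCol A Y j ^ (1 - γ)) < ‖A i i‖ * ‖A j j‖) : IsGDD A := by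
  obtain ⟨x, hx, rfl⟩ := hX
  obtain ⟨y, hy, rfl⟩ := hY
  rw [wRow_diagonal hx, wCol_diagonal hy] at h
  have : Nontrivial (Fin n) := Fin.nontrivial_iff_two_le.mpr hn
  exact isGDD_iff_rowDom.mpr (rowDom_of_brauer (fun _ _ => norm_nonneg _) hx hy hγ.1 hγ.2 h)

/-- At `γ = 1` the column factors have exponent 0, so the second scaling is a placeholder. -/
lemma isGDD_of_brauer_row (hn : 2 ≤ n) {X : Matrix (Fin n) (Fin n) ℂ} (hX : X ∈ posDiag n)
    (h : ∀ i j, i ≠ j → wRow A X i * wRow A X j < ‖A i i‖ * ‖A j j‖) : IsGDD A :=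
  isGDD_of_brauer hn hX hX (γ := 1) (by simp) (by simpa using h)

lemma isGDD_of_brauer_col (hn : 2 ≤ n) {Y : Matrix (Fin n) (Fin n) ℂ} (hY : Y ∈ posDiag n)
    (h : ∀ i j, i ≠ j → wCol A Y i * wCol A Y j < ‖A i i‖ * ‖A j j‖) : IsGDD A :=
  isGDD_of_brauer hn hY hY (γ := 0) (by simp) (by simpa using h)

/-- The geometric mean of two scalings. -/
lemma exists_posDiag_geom_mean {X Y : Matrix (Fin n) (Fin n) ℂ} (hX : X ∈ posDiag n)
    (hY : Y ∈ posDiag n) {γ : ℝ} (hγ : γ ∈ Set.Icc (0 : ℝ) 1) :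
    ∃ Z ∈ posDiag n, (∀ i, wRow A Z i ≤ wRow A X i ^ γ * wRow A Y i ^ (1 - γ)) ∧
      ∀ i, wCol A Z i ≤ wCol A X i ^ γ * wCol A Y i ^ (1 - γ) := by
  obtain ⟨x, hx, rfl⟩ := hX
  obtain ⟨y, hy, rfl⟩ := hY
  have hz : ∀ i, 0 < x i ^ γ * y i ^ (1 - γ) := fun i =>
    mul_pos (Real.rpow_pos_of_pos (hx i) _) (Real.rpow_pos_of_pos (hy i) _)
  refine ⟨_, ⟨_, hz, rfl⟩, ?_, ?_⟩
  · rw [wRow_diagonal hz, wRow_diagonal hx, wRow_diagonal hy]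
    exact scaledRow_geom_mean_le (fun _ _ => norm_nonneg _) hx hy hγ.1 hγ.2
  · rw [wCol_diagonal hz, wCol_diagonal hx, wCol_diagonal hy]
    exact scaledCol_geom_mean_le (fun _ _ => norm_nonneg _) hx hy hγ.1 hγ.2

/-- Two row scalings merge into their geometric mean, to which the product of the inequalities for
`(i, j)` and `(j, i)` applies. -/
lemma isGDD_of_weighted_row (hn : 2 ≤ n) {X Y : Matrix (Fin n) (Fin n) ℂ} (hX : X ∈ posDiag n)
    (hY : Y ∈ posDiag n) {α : ℝ} (hα : α ∈ Set.Icc (0 : ℝ) 1)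
    (h : ∀ i j, i ≠ j → wRow A X i ^ α * wRow A Y j ^ (1 - α) <
      ‖A i i‖ ^ α * ‖A j j‖ ^ (1 - α)) : IsGDD A := by
  obtain ⟨Z, hZ, hrow, -⟩ := exists_posDiag_geom_mean (A := A) hX hY hα
  refine isGDD_of_brauer_row hn hZ fun i j hij => lt_of_le_of_lt
    (mul_le_mul (hrow i) (hrow j) (wRow_nonneg _ _) ((wRow_nonneg _ _).trans (hrow i))) ?_
  exact mul_lt_of_weighted (wRow_nonneg _ _) (wRow_nonneg _ _) (wRow_nonneg _ _) (wRow_nonneg _ _)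
    (norm_nonneg _) (norm_nonneg _) hα.1 hα.2 (h i j hij) (h j i hij.symm)

lemma isGDD_of_weighted_col (hn : 2 ≤ n) {X Y : Matrix (Fin n) (Fin n) ℂ} (hX : X ∈ posDiag n)
    (hY : Y ∈ posDiag n) {α : ℝ} (hα : α ∈ Set.Icc (0 : ℝ) 1)
    (h : ∀ i j, i ≠ j → wCol A X i ^ α * wCol A Y j ^ (1 - α) <
      ‖A i i‖ ^ α * ‖A j j‖ ^ (1 - α)) : IsGDD A := by
  obtain ⟨Z, hZ, -, hcol⟩ := exists_posDiag_geom_mean (A := A) hX hY hα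
  refine isGDD_of_brauer_col hn hZ fun i j hij => lt_of_le_of_lt
    (mul_le_mul (hcol i) (hcol j) (wCol_nonneg _ _) ((wCol_nonneg _ _).trans (hcol i))) ?_
  exact mul_lt_of_weighted (wCol_nonneg _ _) (wCol_nonneg _ _) (wCol_nonneg _ _) (wCol_nonneg _ _)
    (norm_nonneg _) (norm_nonneg _) hα.1 hα.2 (h i j hij) (h j i hij.symm)

lemma isGDD_of_weighted_row_col (hn : 2 ≤ n) {X Y : Matrix (Fin n) (Fin n) ℂ}
    (hX : X ∈ posDiag n) (hY : Y ∈ posDiag n) {α : ℝ} (hα : α ∈ Set.Icc (0 : ℝ) 1)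
    (h : ∀ i j, i ≠ j → wRow A X i ^ α * wCol A Y j ^ (1 - α) <
      ‖A i i‖ ^ α * ‖A j j‖ ^ (1 - α)) : IsGDD A :=
  isGDD_of_brauer hn hX hY hα fun i j hij =>
    mul_lt_of_weighted (wRow_nonneg _ _) (wRow_nonneg _ _) (wCol_nonneg _ _) (wCol_nonneg _ _)
      (norm_nonneg _) (norm_nonneg _) hα.1 hα.2 (h i j hij) (h j i hij.symm)

lemma isGDD_of_crossed (hn : 2 ≤ n) {X Y : Matrix (Fin n) (Fin n) ℂ} (hX : X ∈ posDiag n)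
    (hY : Y ∈ posDiag n) {α : ℝ} (hα : α ∈ Set.Icc (0 : ℝ) 1)
    (h : ∀ i j, i ≠ j → (wRow A X i * wCol A Y j) ^ α * (wRow A X j * wCol A Y i) ^ (1 - α) <
      ‖A i i‖ * ‖A j j‖) : IsGDD A :=
  isGDD_of_brauer hn hX hY (γ := 1 / 2) (by norm_num) fun i j hij =>
    mul_lt_of_crossed (wRow_nonneg _ _) (wRow_nonneg _ _) (wCol_nonneg _ _) (wCol_nonneg _ _)
      (norm_nonneg _) (norm_nonneg _) hα.1 hα.2 (h i j hij) (h j i hij.symm)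

lemma isGDD_of_weighted_geom (hn : 2 ≤ n) {X Y : Matrix (Fin n) (Fin n) ℂ} (hX : X ∈ posDiag n)
    (hY : Y ∈ posDiag n) {α β : ℝ} (hα : α ∈ Set.Icc (0 : ℝ) 1) (hβ : β ∈ Set.Icc (0 : ℝ) 1)
    (h : ∀ i j, i ≠ j → (wRow A X i ^ β * wCol A Y i ^ (1 - β)) ^ α *
      (wRow A X j ^ β * wCol A Y j ^ (1 - β)) ^ (1 - α) <
      ‖A i i‖ ^ α * ‖A j j‖ ^ (1 - α)) : IsGDD A := by
  have hs : ∀ i, 0 ≤ wRow A X i ^ β * wCol A Y i ^ (1 - β) := fun i =>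
    mul_nonneg (Real.rpow_nonneg (wRow_nonneg _ _) _) (Real.rpow_nonneg (wCol_nonneg _ _) _)
  exact isGDD_of_brauer hn hX hY hβ fun i j hij =>
    mul_lt_of_weighted_self (hs i) (hs j) (norm_nonneg _) (norm_nonneg _) hα.1 hα.2
      (h i j hij) (h j i hij.symm)

lemma isGDD_of_weighted_geom_swapped (hn : 2 ≤ n) {X Y : Matrix (Fin n) (Fin n) ℂ}
    (hX : X ∈ posDiag n) (hY : Y ∈ posDiag n) {α β : ℝ} (hα : α ∈ Set.Icc (0 : ℝ) 1)
    (hβ : β ∈ Set.Icc (0 : ℝ) 1)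
    (h : ∀ i j, i ≠ j → (wRow A X i ^ β * wCol A Y i ^ (1 - β)) ^ α *
      (wCol A Y j ^ β * wRow A X j ^ (1 - β)) ^ (1 - α) <
      ‖A i i‖ ^ α * ‖A j j‖ ^ (1 - α)) : IsGDD A := by
  have hs : ∀ i, 0 ≤ wRow A X i ^ β * wCol A Y i ^ (1 - β) := fun i =>
    mul_nonneg (Real.rpow_nonneg (wRow_nonneg _ _) _) (Real.rpow_nonneg (wCol_nonneg _ _) _)
  have hs' : ∀ i, 0 ≤ wCol A Y i ^ β * wRow A X i ^ (1 - β) := fun i =>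
    mul_nonneg (Real.rpow_nonneg (wCol_nonneg _ _) _) (Real.rpow_nonneg (wRow_nonneg _ _) _)
  obtain ⟨hα0, hα1⟩ := hα
  obtain ⟨hβ0, hβ1⟩ := hβ
  -- This `γ` is the total exponent of the row sum once the swapped inequalities are multiplied
  -- together.
  refine isGDD_of_brauer hn hX hY (γ := β * α + (1 - β) * (1 - α))
    ⟨by nlinarith, by nlinarith⟩ fun i j hij => ?_
  rw [← rpow_mul_rpow_swapped (wRow_nonneg X i) (wCol_nonneg Y i) hα0 hα1 hβ0 hβ1,
    ← rpow_mul_rpow_swapped (wRow_nonneg X j) (wCol_nonneg Y j) hα0 hα1 hβ0 hβ1]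
  exact mul_lt_of_weighted (hs i) (hs j) (hs' i) (hs' j) (norm_nonneg _) (norm_nonneg _) hα0 hα1
    (h i j hij) (h j i hij.symm)

/-! ### Arithmetic-geometric comparisons and the list of criteria -/

lemma geom_le_arith {α p q : ℝ} (hα : α ∈ Set.Icc (0 : ℝ) 1) (hp : 0 ≤ p) (hq : 0 ≤ q) :
    p ^ α * q ^ (1 - α) ≤ α * p + (1 - α) * q :=
  Real.geom_mean_le_arith_mean2_weighted hα.1 (sub_nonneg.mpr hα.2) hp hq (by ring)

lemma geom_mul_geom_le {α p q c d : ℝ} (hα : α ∈ Set.Icc (0 : ℝ) 1) (hp : 0 ≤ p) (hq : 0 ≤ q)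
    (hc : 0 ≤ c) (hd : 0 ≤ d) :
    (p ^ α * q ^ (1 - α)) * (c ^ α * d ^ (1 - α)) ≤
      (α * p + (1 - α) * q) * (α * c + (1 - α) * d) := by
  have h1 : 0 ≤ p ^ α * q ^ (1 - α) := by positivity
  exact mul_le_mul (geom_le_arith hα hp hq) (geom_le_arith hα hc hd) (by positivity)
    (h1.trans (geom_le_arith hα hp hq))

lemma weighted_geom_le {α β p q c d : ℝ} (hα : α ∈ Set.Icc (0 : ℝ) 1)
    (hβ : β ∈ Set.Icc (0 : ℝ) 1) (hp : 0 ≤ p) (hq : 0 ≤ q) (hc : 0 ≤ c) (hd : 0 ≤ d) :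
    (p ^ β * q ^ (1 - β)) ^ α * (c ^ β * d ^ (1 - β)) ^ (1 - α) ≤
      (β * p + (1 - β) * q) ^ α * (β * c + (1 - β) * d) ^ (1 - α) := by
  have h1 : 0 ≤ p ^ β * q ^ (1 - β) := by positivity
  have h2 : 0 ≤ c ^ β * d ^ (1 - β) := by positivity
  exact mul_le_mul (Real.rpow_le_rpow h1 (geom_le_arith hβ hp hq) hα.1)
    (Real.rpow_le_rpow h2 (geom_le_arith hβ hc hd) (sub_nonneg.mpr hα.2)) (by positivity)
    (Real.rpow_nonneg (h1.trans (geom_le_arith hβ hp hq)) _)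

lemma IsGDD.exists_criterion (h : IsGDD A) {k : ℕ} (hk₁ : 1 ≤ k) (hk₂ : k ≤ 22) :
    ∃ X ∈ posDiag n, ∃ Y ∈ posDiag n, ∃ α ∈ Set.Icc (0 : ℝ) 1, ∃ β ∈ Set.Icc (0 : ℝ) 1,
      ∀ i j : Fin n, i ≠ j → Criterion A X Y α β i j k := by
  obtain ⟨X, hX, hr⟩ := h.exists_wRow_lt
  obtain ⟨Y, hY, hc⟩ := h.exists_wCol_lt
  have hr0 := wRow_nonneg (A := A) X
  have hc0 := wCol_nonneg (A := A) Y
  by_cases hk : k = 15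
  · subst hk
    -- This criterion alone has column sums in its first scaling, so the column scaling must fill
    -- both places.
    refine ⟨Y, hY, Y, hY, 1, by simp, 1, by simp, fun i j _ => ?_⟩
    simpa [Criterion] using hc i
  refine ⟨X, hX, Y, hY, 1, by simp, 1, by simp, fun i j _ => ?_⟩
  have hrr := mul_lt_mul'' (hr i) (hr j) (hr0 i) (hr0 j)
  have hcc := mul_lt_mul'' (hc i) (hc j) (hc0 i) (hc0 j)
  have hrc := mul_lt_mul'' (hr i) (hc j) (hr0 i) (hc0 j)
  have hri := hr i
  have hci := hc i
  unfold Criterion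
  split
  all_goals first
    | exact absurd rfl hk
    | (try simp only [sub_self, Real.rpow_one, Real.rpow_zero, one_mul, zero_mul, mul_one,
        add_zero, gt_iff_lt]
       with_reducible assumption)
    | (interval_cases k <;> contradiction)

lemma isGDD_of_criterion (hn : 2 ≤ n) {k : ℕ} {X Y : Matrix (Fin n) (Fin n) ℂ}
    (hX : X ∈ posDiag n) (hY : Y ∈ posDiag n) {α β : ℝ} (hα : α ∈ Set.Icc (0 : ℝ) 1)
    (hβ : β ∈ Set.Icc (0 : ℝ) 1)
    (h : ∀ i j : Fin n, i ≠ j → Criterion A X Y α β i j k) : IsGDD A := by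
  have hr0 := wRow_nonneg (A := A) X
  have hc0 := wCol_nonneg (A := A) Y
  have : Nontrivial (Fin n) := Fin.nontrivial_iff_two_le.mpr hn
  -- The first four criteria do not involve `j`, but are assumed only for pairs `i ≠ j`; some
  -- partner must exist.
  have hne : ∀ i : Fin n, ∃ j, i ≠ j := fun i => (exists_ne i).imp fun _ => Ne.symm
  unfold Criterion at h
  split at h
  · exact isGDD_of_wRow_lt hX fun i => (hne i).elim fun j hij => h i j hij
  · exact isGDD_of_wCol_lt hY fun i => (hne i).elim fun j hij => h i j hij
  · exact isGDD_of_ostrowski hX hY hα fun i => (hne i).elim fun j hij => h i j hij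
  · exact isGDD_of_ostrowski hX hY hα fun i => (hne i).elim fun j hij =>
      (geom_le_arith hα (hr0 i) (hc0 i)).trans_lt (h i j hij)
  · exact isGDD_of_brauer_row hn hX h
  · exact isGDD_of_brauer_col hn hY h
  · exact isGDD_of_crossed hn hX hY (α := 1) (by simp) (by simpa using h)
  · refine isGDD_of_brauer hn hX hY hα fun i j hij => lt_of_eq_of_lt ?_ (h i j hij)
    rw [Real.mul_rpow (hr0 i) (hr0 j), Real.mul_rpow (hc0 i) (hc0 j), mul_mul_mul_comm]
  · exact isGDD_of_crossed hn hX hY hα h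
  · refine isGDD_of_brauer hn hX hY hα fun i j hij => lt_of_le_of_lt ?_ (h i j hij)
    rw [mul_mul_mul_comm, ← Real.mul_rpow (hr0 i) (hr0 j), ← Real.mul_rpow (hc0 i) (hc0 j)]
    exact geom_le_arith hα (mul_nonneg (hr0 i) (hr0 j)) (mul_nonneg (hc0 i) (hc0 j))
  · exact isGDD_of_crossed hn hX hY hα fun i j hij =>
      (geom_le_arith hα (mul_nonneg (hr0 i) (hc0 j)) (mul_nonneg (hr0 j) (hc0 i))).trans_lt
        (h i j hij)
  · exact isGDD_of_brauer hn hX hY hα fun i j hij =>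
      (geom_mul_geom_le hα (hr0 i) (hc0 i) (hr0 j) (hc0 j)).trans_lt (h i j hij)
  · refine isGDD_of_crossed hn hX hY hα fun i j hij => lt_of_le_of_lt ?_ (h i j hij)
    refine le_of_eq_of_le ?_ (geom_mul_geom_le hα (hr0 i) (hc0 i) (hc0 j) (hr0 j))
    rw [Real.mul_rpow (hr0 i) (hc0 j), Real.mul_rpow (hr0 j) (hc0 i)]
    ring
  · exact isGDD_of_weighted_row hn hX hY hα h
  · exact isGDD_of_weighted_col hn hX hY hα h
  · exact isGDD_of_weighted_row_col hn hX hY hα h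
  · exact isGDD_of_weighted_geom hn hX hY hα hβ h
  · exact isGDD_of_weighted_geom_swapped hn hX hY hα hβ h
  · refine isGDD_of_weighted_geom hn hX hY hα hβ fun i j hij => lt_of_le_of_lt ?_ (h i j hij)
    -- Interchanging the two geometric means puts the `β`-mean outside, where it meets the
    -- arithmetic mean of the criterion.
    rw [rpow_mul_rpow_comm (hr0 i) (hc0 i) (hr0 j) (hc0 j)]
    exact geom_le_arith hβ
      (mul_nonneg (Real.rpow_nonneg (hr0 i) _) (Real.rpow_nonneg (hr0 j) _))
      (mul_nonneg (Real.rpow_nonneg (hc0 i) _) (Real.rpow_nonneg (hc0 j) _))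
  · refine isGDD_of_weighted_geom_swapped hn hX hY hα hβ fun i j hij =>
      lt_of_le_of_lt ?_ (h i j hij)
    rw [rpow_mul_rpow_comm (hr0 i) (hc0 i) (hc0 j) (hr0 j)]
    exact geom_le_arith hβ
      (mul_nonneg (Real.rpow_nonneg (hr0 i) _) (Real.rpow_nonneg (hc0 j) _))
      (mul_nonneg (Real.rpow_nonneg (hc0 i) _) (Real.rpow_nonneg (hr0 j) _))
  · exact isGDD_of_weighted_geom hn hX hY hα hβ fun i j hij =>
      (weighted_geom_le hα hβ (hr0 i) (hc0 i) (hr0 j) (hc0 j)).trans_lt (h i j hij)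
  · exact isGDD_of_weighted_geom_swapped hn hX hY hα hβ fun i j hij =>
      (weighted_geom_le hα hβ (hr0 i) (hc0 i) (hc0 j) (hr0 j)).trans_lt (h i j hij)
  -- Outside the list the criterion is `False`, which any one pair of distinct indices refutes.
  · obtain ⟨j, hj⟩ := hne ⟨0, by omega⟩
    exact (h _ j hj).elim

end

end GenDiagDom

theorem theorem4p3 (n : ℕ) (hn : 2 ≤ n) (A : Matrix (Fin n) (Fin n) ℂ)
    (k : ℕ) (hk₁ : 1 ≤ k) (hk₂ : k ≤ 22) :
    GenDiagDom.IsGDD A ↔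
      ∃ X ∈ GenDiagDom.posDiag n, ∃ Y ∈ GenDiagDom.posDiag n,
        ∃ α ∈ Set.Icc (0 : ℝ) 1, ∃ β ∈ Set.Icc (0 : ℝ) 1,
          ∀ i j : Fin n, i ≠ j → GenDiagDom.Criterion A X Y α β i j k :=
  ⟨fun h => h.exists_criterion hk₁ hk₂, fun ⟨_, hX, _, hY, _, hα, _, hβ, h⟩ =>
    GenDiagDom.isGDD_of_criterion hn hX hY hα hβ h⟩
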